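/- Let $d_u,d_s\ge 0$ and $d=d_u+d_s$; write points of $\mathbb R^d$ as $x=(x_1,x_2)$ with $x_1\in\mathbb R^{d_u}$, $x_2\in\mathbb R^{d_s}$, let $|\cdot|$ be the Euclidean norm, let $\|\cdot\|$ be the operator norm with respect to it, and put $$\overline B_\infty=\{(x_1,x_2):\max(|x_1|,|x_2|)\le 1\},\quad \overline B_u=\{x_1\in\mathbb R^{d_u}:|x_1|\le 1\},\quad \overline B_s=\{x_2\in\mathbb R^{d_s}:|x_2|\le 1\}.$$ Let $N\ge 1$ be an integer and let $0<\lambda<1<\mu$ and $C_0>0$. There exists $\delta>0$, depending only on $d,N,\lambda,\mu,C_0$, such that the following holds. Let $U,V\subset\mathbb R^d$ be open sets with $\overline B_\infty\subset U\cap V$, and let $\varphi_m:U\to V$, $m\in\mathbb Z$, be $C^{N+1}$ diffeomorphisms such that for all $m\in\mathbb Z$: (a) $\varphi_m(0)=0$ and $d\varphi_m(0)(x_1,x_2)=(A_{1,m}x_1,A_{2,m}x_2)$, where the invertible linear maps $A_{1,m}:\mathbb R^{d_u}\to\mathbb R^{d_u}$ and $A_{2,m}:\mathbb R^{d_s}\to\mathbb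 R^{d_s}$ satisfy $\|A_{1,m}^{-1}\|\le\mu^{-1}$, $\|A_{2,m}\|\le\lambda$ and $\max(\|A_{1,m}\|,\|A_{2,m}^{-1}\|)\le C_0$; (b) $\sup_U|\partial^\alpha\varphi_m|\le\delta$ for all multiindices $\alpha$ with $2\le|\alpha|\le N+1$. Then there exist $C^N$ functions $F^u_m:\overline B_u\to\overline B_s$ and $F^s_m:\overline B_s\to\overline B_u$, $m\in\mathbb Z$, bounded in $C^N$ uniformly in $m$, with $F^u_m(0)=0$, $dF^u_m(0)=0$, $F^s_m(0)=0$, $dF^s_m(0)=0$, such that the graphs $$W^u_m=\{(x_1,x_2):|x_1|\le 1,\ x_2=F^u_m(x_1)\},\qquad W^s_m=\{(x_1,x_2):|x_2|\le 1,\ x_1=F^s_m(x_2)\}$$ have the following properties for all $m\in\mathbb Z$: 1. $\varphi_m^{-1}(W^u_{m+1})\subset W^u_m$ and $\varphi_m(W^s_m)\subset W^s_{m+1}$; more precisely, $\varphi_m(W^u_m)\cap\overline B_\infty=W^u_{m+1}$ and $\varphi_m^{-1}(W^s_{m+1})\cap\overline B_\infty=W^s_m$; 2. $W^u_m\cap W^s_m=\{0\}$;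 3. for each $x\in W^u_m$, $\varphi_{m-n}^{-1}\cdots\varphi_{m-1}^{-1}(x)\to 0$ as $n\to\infty$; 4. for each $x\in W^s_m$, $\varphi_{m+n-1}\cdots\varphi_m(x)\to 0$ as $n\to\infty$; 5. if $\varphi_{m-n}^{-1}\cdots\varphi_{m-1}^{-1}(x)\in\overline B_\infty$ for all $n\ge 0$, then $x\in W^u_m$; 6. if $\varphi_{m+n-1}\cdots\varphi_m(x)\in\overline B_\infty$ for all $n\ge 0$, then $x\in W^s_m$. -/

import Mathlib

open Set Filter Topology

namespace HypFamily

/-- The Euclidean space of dimension `n`. -/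
abbrev Euc (n : ℕ) : Type := EuclideanSpace ℝ (Fin n)

/-- The space of pairs `(x₁, x₂)`, with `x₁` in the unstable and `x₂` in the stable factor. Its
type carries the product topology and smooth structure; where the size of a vector matters, the
norm is written out. -/
abbrev Space (du ds : ℕ) : Type := Euc du × Euc ds

/-- The Euclidean norm of `(x₁, x₂)`, that is `√(|x₁|² + |x₂|²)`. -/
noncomputable def eucNorm {du ds : ℕ} (x : Space du ds) : ℝ := ‖WithLp.toLp 2 x‖

/-- The closed unit ball `{(x₁, x₂) : max (|x₁|, |x₂|) ≤ 1}`. -/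
def unitBox (du ds : ℕ) : Set (Space du ds) := {x | max ‖x.1‖ ‖x.2‖ ≤ 1}

/-- The closed Euclidean unit ball. -/
def unitBall (n : ℕ) : Set (Euc n) := {x | ‖x‖ ≤ 1}

/-- The standard coordinate vectors of `ℝ^(du + ds)`. -/
noncomputable def coordVec (du ds : ℕ) : Fin du ⊕ Fin ds → Space du ds :=
  Sum.elim (fun i => (EuclideanSpace.single i 1, 0)) (fun i => (0, EuclideanSpace.single i 1))

/-- The partial derivative `∂_{j 0} ⋯ ∂_{j (k-1)} f (x)` of order `k`. Every derivative `∂^α f`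
with `|α| = k` is of this form. -/
noncomputable def partialDeriv {du ds k : ℕ} (f : Space du ds → Space du ds)
    (j : Fin k → Fin du ⊕ Fin ds) (x : Space du ds) : Space du ds :=
  iteratedFDeriv ℝ k f x (fun i => coordVec du ds (j i))

/-- The graph `{(x₁, x₂) : |x₁| ≤ 1, x₂ = F x₁}`. -/
def unstableGraph {du ds : ℕ} (F : Euc du → Euc ds) : Set (Space du ds) :=
  {x | ‖x.1‖ ≤ 1 ∧ x.2 = F x.1}

/-- The graph `{(x₁, x₂) : |x₂| ≤ 1, x₁ = F x₂}`. -/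
def stableGraph {du ds : ℕ} (F : Euc ds → Euc du) : Set (Space du ds) :=
  {x | ‖x.2‖ ≤ 1 ∧ x.1 = F x.2}

/-- `forward φ m n x = φ_{m+n-1} ⋯ φ_m (x)`. -/
def forward {X : Type*} [TopologicalSpace X] (φ : ℤ → OpenPartialHomeomorph X X) (m : ℤ) :
    ℕ → X → X
  | 0, x => x
  | n + 1, x => φ (m + n) (forward φ m n x)

/-- `backward φ m n x = φ_{m-n}⁻¹ ⋯ φ_{m-1}⁻¹ (x)`. -/
def backward {X : Type*} [TopologicalSpace X] (φ : ℤ → OpenPartialHomeomorph X X) (m : ℤ) :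
    ℕ → X → X
  | 0, x => x
  | n + 1, x => (φ (m - (n + 1))).symm (backward φ m n x)

/-- The standing assumptions on the family `φ_m : U → V`: `C^(N+1)` diffeomorphisms between open
sets that contain the closed unit ball, fixing `0`, with block diagonal differential at `0` whose
blocks are uniformly expanding and contracting, and with partial derivatives of the orders
`2, …, N + 1` bounded by `δ` on `U`. -/
structure IsHyperbolic {du ds : ℕ} (N : ℕ) (lam μ C₀ δ : ℝ) (U V : Set (Space du ds))
    (φ : ℤ → OpenPartialHomeomorph (Space du ds) (Space du ds)) : Prop where
  source_eq : ∀ m, (φ m).source = U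
  target_eq : ∀ m, (φ m).target = V
  box_subset : unitBox du ds ⊆ U ∩ V
  contDiffOn : ∀ m, ContDiffOn ℝ (N + 1 : ℕ) (φ m) U
  contDiffOn_symm : ∀ m, ContDiffOn ℝ (N + 1 : ℕ) (φ m).symm V
  map_zero : ∀ m, φ m 0 = 0
  differential : ∀ m, ∃ (A₁ : Euc du ≃L[ℝ] Euc du) (A₂ : Euc ds ≃L[ℝ] Euc ds),
    HasFDerivAt (φ m)
      ((A₁ : Euc du →L[ℝ] Euc du).prodMap (A₂ : Euc ds →L[ℝ] Euc ds)) 0 ∧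
    ‖(A₁.symm : Euc du →L[ℝ] Euc du)‖ ≤ μ⁻¹ ∧
    ‖(A₂ : Euc ds →L[ℝ] Euc ds)‖ ≤ lam ∧
    max ‖(A₁ : Euc du →L[ℝ] Euc du)‖ ‖(A₂.symm : Euc ds →L[ℝ] Euc ds)‖ ≤ C₀
  deriv_le : ∀ m, ∀ k : ℕ, 2 ≤ k → k ≤ N + 1 → ∀ j : Fin k → Fin du ⊕ Fin ds, ∀ x ∈ U,
    eucNorm (partialDeriv (φ m) j x) ≤ δ

/-- `(F_m)` is a family of `C^N` functions from the closed unit ball of `ℝ^a` to the closed unit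
ball of `ℝ^b`, bounded in `C^N` uniformly in `m`, with `F_m(0) = 0` and `dF_m(0) = 0`. Only the
values of `F_m` on the ball are meaningful. -/
structure IsGraphFamily {a b : ℕ} (N : ℕ) (F : ℤ → Euc a → Euc b) : Prop where
  mapsTo : ∀ m, MapsTo (F m) (unitBall a) (unitBall b)
  contDiffOn : ∀ m, ContDiffOn ℝ N (F m) (unitBall a)
  map_zero : ∀ m, F m 0 = 0
  differential : ∀ m, HasFDerivAt (F m) (0 : Euc a →L[ℝ] Euc b) 0
  bounded : ∃ C : ℝ, ∀ m, ∀ k ≤ N, ∀ x ∈ unitBall a,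
    ‖iteratedFDerivWithin ℝ k (F m) (unitBall a) x‖ ≤ C

end HypFamily

/-! The proof is a Perron–Irwin argument: the invariant manifolds are sets of half-orbits that stay
in the box, and these orbits are fixed points in a space of bounded sequences. Write `φ m` as its
linear part plus a remainder, which has Lipschitz constant `ε` on a ball of radius `r > 1`. Along a
half-orbit, solve for the contracted component forward and for the expanded one backward, through
the inverse of its linear block. Both linear rates are then at most `κ = max lam μ⁻¹`, and if `κ + ε
< 1` the recursion is a contraction whose only free datum is the initial value of the contracted
component.

The fixed point is taken in bounded families over `ℤ × ℕ`, that is, for all starting times at once,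
so that one smooth solution map carries the uniformity in `m`. Its smoothness follows from the
inverse function theorem (`exists_solution`), because a superposition operator on bounded families
is `C^N` when its entries have uniformly bounded derivatives up to order `N + 1`
(`contDiffOn_superposition`). Evaluation at time `0` gives the graph functions
(`exists_graphFamily`).

The estimates on `IsOrbit` give decay of the orbits, tangency at `0`, and cone bounds that force the
two graphs to meet only at `0`. Invariance is a shift of the orbit by one step. -/

namespace HypFamily

open BoundedContinuousFunction Metric

/-! ### Superposition operators on bounded families -/

section Families

variable {ι E F : Type*} [TopologicalSpace ι] [NormedAddCommGroup E] [NormedAddCommGroup F]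

theorem apply_mem_ball {x : ι →ᵇ E} {r : ℝ} (hx : x ∈ ball (0 : ι →ᵇ E) r) (i : ι) :
    x i ∈ ball (0 : E) r := by
  rw [mem_ball_zero_iff] at hx ⊢
  exact (x.norm_coe_le_norm i).trans_lt hx

variable [DiscreteTopology ι]

open Classical in
/-- The superposition operator `x ↦ (f i (x i))_i` on bounded families; its value is `0` where the
family `f i (x i)` is unbounded. -/
noncomputable def superposition (f : ι → E → F) (x : ι →ᵇ E) : ι →ᵇ F :=
  if h : ∃ C : ℝ, ∀ i, ‖f i (x i)‖ ≤ C then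
    ofNormedAddCommGroupDiscrete (fun i => f i (x i)) h.choose h.choose_spec else 0

theorem superposition_apply {f : ι → E → F} {x : ι →ᵇ E} (h : ∃ C : ℝ, ∀ i, ‖f i (x i)‖ ≤ C)
    (i : ι) : superposition f x i = f i (x i) := by
  simp [superposition, dif_pos h]

end Families

section Superposition

variable {ι : Type*} {E F : Type}
  [NormedAddCommGroup E] [NormedSpace ℝ E] [NormedAddCommGroup F] [NormedSpace ℝ F]

/-- The functions `f i` are `C^n` on `s`, with derivatives up to the order `n` bounded uniformly
in `i`. -/
structure UniformlySmoothOn (n : ℕ) (f : ι → E → F) (s : Set E) : Prop where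
  contDiffOn : ∀ i, ContDiffOn ℝ n (f i) s
  bounded : ∃ C : ℝ, ∀ k ≤ n, ∀ i, ∀ x ∈ s, ‖iteratedFDeriv ℝ k (f i) x‖ ≤ C

theorem UniformlySmoothOn.mono {n m : ℕ} {f : ι → E → F} {s : Set E}
    (hf : UniformlySmoothOn n f s) (hmn : m ≤ n) : UniformlySmoothOn m f s := by
  obtain ⟨C, hC⟩ := hf.bounded
  exact ⟨fun i => (hf.contDiffOn i).of_le (by exact_mod_cast hmn),
    C, fun k hk => hC k (hk.trans hmn)⟩

theorem UniformlySmoothOn.fderiv {n : ℕ} {f : ι → E → F} {s : Set E}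
    (hf : UniformlySmoothOn (n + 1) f s) (hs : IsOpen s) :
    UniformlySmoothOn n (fun i => fderiv ℝ (f i)) s := by
  obtain ⟨C, hC⟩ := hf.bounded
  refine ⟨fun i => (hf.contDiffOn i).fderiv_of_isOpen hs (by norm_cast), C, ?_⟩
  intro k hk i x hx
  rw [norm_iteratedFDeriv_fderiv]
  exact hC (k + 1) (by omega) i x hx

theorem UniformlySmoothOn.exists_norm_le {n : ℕ} {f : ι → E → F} {s : Set E}
    (hf : UniformlySmoothOn n f s) : ∃ C : ℝ, ∀ i, ∀ x ∈ s, ‖f i x‖ ≤ C := by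
  obtain ⟨C, hC⟩ := hf.bounded
  exact ⟨C, fun i x hx => by simpa using hC 0 (Nat.zero_le _) i x hx⟩

theorem UniformlySmoothOn.exists_lipschitz {n : ℕ} {f : ι → E → F} {s : Set E}
    (hf : UniformlySmoothOn (n + 1) f s) (hs : IsOpen s) (hc : Convex ℝ s) :
    ∃ C : ℝ, 0 ≤ C ∧ ∀ i, ∀ x ∈ s, ∀ y ∈ s, ‖f i x - f i y‖ ≤ C * ‖x - y‖ := by
  obtain ⟨C, hC⟩ := hf.bounded
  refine ⟨max C 0, le_max_right _ _, fun i x hx y hy => ?_⟩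
  refine hc.norm_image_sub_le_of_norm_fderiv_le (𝕜 := ℝ) (fun z hz => ?_) (fun z hz => ?_) hy hx
  · exact ((hf.contDiffOn i).contDiffAt (hs.mem_nhds hz)).differentiableAt (by simp)
  · rw [← norm_iteratedFDeriv_one]
    exact (hC 1 (by omega) i z hz).trans (le_max_left _ _)

variable [TopologicalSpace ι]

theorem norm_diagonal_le (L : ι →ᵇ (E →L[ℝ] F)) (x : ι →ᵇ E) (i : ι) :
    ‖L i (x i)‖ ≤ ‖L‖ * ‖x‖ :=
  ((L i).le_opNorm _).trans (mul_le_mul (L.norm_coe_le_norm i) (x.norm_coe_le_norm i)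
    (norm_nonneg _) (norm_nonneg L))

variable [DiscreteTopology ι]

theorem UniformlySmoothOn.superposition_apply {n : ℕ} {f : ι → E → F} {r : ℝ}
    (hf : UniformlySmoothOn n f (ball 0 r)) {x : ι →ᵇ E} (hx : x ∈ ball (0 : ι →ᵇ E) r) (i : ι) :
    superposition f x i = f i (x i) := by
  obtain ⟨C, hC⟩ := hf.exists_norm_le
  exact HypFamily.superposition_apply ⟨C, fun j => hC j _ (apply_mem_ball hx j)⟩ i

/-- The diagonal operator on bounded families given by a bounded family of operators. -/
noncomputable def diagonal : (ι →ᵇ (E →L[ℝ] F)) →L[ℝ] (ι →ᵇ E) →L[ℝ] (ι →ᵇ F) :=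
  LinearMap.mkContinuous₂
    (LinearMap.mk₂ ℝ
      (fun (L : ι →ᵇ (E →L[ℝ] F)) (x : ι →ᵇ E) =>
        ofNormedAddCommGroupDiscrete (fun i => L i (x i)) (‖L‖ * ‖x‖) (norm_diagonal_le L x))
      (fun _ _ _ => by ext; simp) (fun _ _ _ => by ext; simp)
      (fun _ _ _ => by ext; simp) (fun _ _ _ => by ext; simp))
    1 (fun L x => by
      rw [one_mul]
      exact (BoundedContinuousFunction.norm_le (by positivity)).mpr (norm_diagonal_le L x))

@[simp]
theorem diagonal_apply (L : ι →ᵇ (E →L[ℝ] F)) (x : ι →ᵇ E) (i : ι) :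
    diagonal L x i = L i (x i) := rfl

/-- The second derivatives are bounded uniformly in the index, so the first-order Taylor error is at
most `C * ‖y - x‖ ^ 2` in every entry and hence in the supremum norm. -/
theorem hasFDerivAt_superposition {f : ι → E → F} {r : ℝ}
    (hf : UniformlySmoothOn 2 f (ball 0 r)) {x : ι →ᵇ E} (hx : x ∈ ball (0 : ι →ᵇ E) r) :
    HasFDerivAt (superposition f) (diagonal (superposition (fun i => fderiv ℝ (f i)) x)) x := by
  have hf' := hf.fderiv isOpen_ball
  obtain ⟨C, hC0, hC⟩ := hf'.exists_lipschitz isOpen_ball (convex_ball _ _)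
  refine .of_isLittleO ?_
  have hO : (fun y => superposition f y - superposition f x -
      diagonal (superposition (fun i => fderiv ℝ (f i)) x) (y - x)) =O[𝓝 x]
      fun y => ‖y - x‖ ^ 2 := by
    refine Asymptotics.IsBigO.of_bound C ?_
    obtain ⟨e, he, hball⟩ := Metric.isOpen_iff.mp isOpen_ball x hx
    filter_upwards [ball_mem_nhds x he] with y hy
    have hyr := hball hy
    rw [BoundedContinuousFunction.norm_le (by positivity)]
    intro i
    simp only [BoundedContinuousFunction.coe_sub, Pi.sub_apply, diagonal_apply,
      hf.superposition_apply hyr, hf.superposition_apply hx, hf'.superposition_apply hx]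
    have hyx : ‖y i - x i‖ ≤ ‖y - x‖ := (y - x).norm_coe_le_norm i
    have hseg : segment ℝ (x i) (y i) ⊆ ball (0 : E) r :=
      (convex_ball _ _).segment_subset (apply_mem_ball hx i) (apply_mem_ball hyr i)
    have := (convex_segment (𝕜 := ℝ) (x i) (y i)).norm_image_sub_le_of_norm_fderiv_le' (𝕜 := ℝ)
      (f := f i) (φ := fderiv ℝ (f i) (x i)) (C := C * ‖y i - x i‖)
      (fun z hz => ((hf.contDiffOn i).contDiffAt
        (isOpen_ball.mem_nhds (hseg hz))).differentiableAt (by simp))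
      (fun z hz => (hC i z (hseg hz) (x i) (apply_mem_ball hx i)).trans
        (mul_le_mul_of_nonneg_left (norm_sub_le_of_mem_segment hz) hC0))
      (left_mem_segment ℝ _ _) (right_mem_segment ℝ _ _)
    refine this.trans ?_
    rw [mul_assoc, ← sq]
    simp only [norm_pow, norm_norm]
    gcongr
  refine hO.trans_isLittleO ?_
  have := (Asymptotics.isLittleO_norm_pow_id (E' := ι →ᵇ E) (n := 2) one_lt_two).comp_tendsto
    (tendsto_sub_nhds_zero_iff.mpr (tendsto_id (x := 𝓝 x)))
  exact this

/-- The derivative is again a superposition operator, that of the derivatives, followed by the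
continuous linear map `diagonal`; this drives the induction, in which the codomain changes. One
order is lost because continuity in the supremum norm needs equicontinuity of the entries, supplied
here by a uniform Lipschitz bound. -/
theorem contDiffOn_superposition {n : ℕ} {f : ι → E → F} {r : ℝ}
    (hf : UniformlySmoothOn (n + 1) f (ball 0 r)) :
    ContDiffOn ℝ n (superposition f) (ball (0 : ι →ᵇ E) r) := by
  induction n generalizing F with
  | zero =>
    obtain ⟨C, hC0, hC⟩ := hf.exists_lipschitz isOpen_ball (convex_ball _ _)
    rw [Nat.cast_zero, contDiffOn_zero]
    refine (LipschitzOnWith.of_dist_le_mul (K := C.toNNReal) fun x hx y hy => ?_).continuousOn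
    rw [dist_eq_norm, dist_eq_norm, Real.coe_toNNReal _ hC0,
      BoundedContinuousFunction.norm_le (by positivity)]
    intro i
    simp only [BoundedContinuousFunction.coe_sub, Pi.sub_apply, hf.superposition_apply hx,
      hf.superposition_apply hy]
    exact (hC i _ (apply_mem_ball hx i) _ (apply_mem_ball hy i)).trans
      (mul_le_mul_of_nonneg_left ((x - y).norm_coe_le_norm i) hC0)
  | succ n ih =>
    have hd : ∀ x ∈ ball (0 : ι →ᵇ E) r, HasFDerivAt (superposition f)
        (diagonal (superposition (fun i => fderiv ℝ (f i)) x)) x :=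
      fun x hx => hasFDerivAt_superposition (hf.mono (by omega)) hx
    rw [Nat.cast_add, Nat.cast_one, contDiffOn_succ_iff_fderiv_of_isOpen isOpen_ball]
    refine ⟨fun x hx => (hd x hx).differentiableAt.differentiableWithinAt, by simp, ?_⟩
    refine ContDiffOn.congr (f := fun x => diagonal (superposition (fun i => fderiv ℝ (f i)) x))
      ?_ fun x hx => (hd x hx).fderiv
    exact (ContinuousLinearMap.contDiff diagonal).comp_contDiffOn (ih (hf.fderiv isOpen_ball))

end Superposition

end HypFamily

namespace HypFamily

open Metric

/-! ### A contracting equation with a parameter -/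

section FixedPoint

variable {A X : Type*} [NormedAddCommGroup A] [NormedSpace ℝ A]
  [NormedAddCommGroup X] [NormedSpace ℝ X] [CompleteSpace X]

/-- The equation `x = Λ (a, x, Φ x)` has a unique small solution, depending smoothly on `a`. -/
theorem exists_solution {n : WithTop ℕ∞} (hn : n ≠ 0) {κ ε r : ℝ} (hκ : 0 ≤ κ) (hε : 0 ≤ ε)
    (hκε : κ + ε < 1)
    (Λ : A × X × X →L[ℝ] X) (hΛ : ∀ a x y, ‖Λ (a, x, y)‖ ≤ max ‖a‖ (κ * ‖x‖ + ‖y‖))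
    {Φ : X → X} (hΦ : ContDiffOn ℝ n Φ (ball 0 r)) (hΦ0 : Φ 0 = 0)
    (hlip : ∀ x ∈ ball (0 : X) r, ∀ y ∈ ball (0 : X) r, ‖Φ x - Φ y‖ ≤ ε * ‖x - y‖) :
    ∃ sol : A → X, ContDiffOn ℝ n sol (ball 0 r) ∧ ∀ a ∈ ball (0 : A) r,
      ‖sol a‖ ≤ ‖a‖ ∧ Λ (a, sol a, Φ (sol a)) = sol a ∧
      ∀ x ∈ ball (0 : X) r, Λ (a, x, Φ x) = x → x = sol a := by
  have hcontr : ∀ a, ∀ x ∈ ball (0 : X) r, ∀ y ∈ ball (0 : X) r,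
      ‖Λ (a, x, Φ x) - Λ (a, y, Φ y)‖ ≤ (κ + ε) * ‖x - y‖ := by
    intro a x hx y hy
    have h1 : Λ (a, x, Φ x) - Λ (a, y, Φ y) = Λ (0, x - y, Φ x - Φ y) := by
      rw [← map_sub]; simp
    have h2 := hΛ 0 (x - y) (Φ x - Φ y)
    rw [norm_zero, max_eq_right (by positivity)] at h2
    rw [h1]
    linarith [hlip x hx y hy]
  have huniq : ∀ a, ∀ x ∈ ball (0 : X) r, ∀ y ∈ ball (0 : X) r,
      Λ (a, x, Φ x) = x → Λ (a, y, Φ y) = y → x = y := by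
    intro a x hx y hy h1 h2
    have h3 := hcontr a x hx y hy
    rw [h1, h2] at h3
    have h4 : ‖x - y‖ ≤ 0 := by nlinarith [norm_nonneg (x - y)]
    exact sub_eq_zero.mp (norm_le_zero_iff.mp h4)
  have hex : ∀ a ∈ ball (0 : A) r, ∃ x : X, ‖x‖ ≤ ‖a‖ ∧ Λ (a, x, Φ x) = x := by
    intro a ha
    rw [mem_ball_zero_iff] at ha
    -- The ball of radius `‖a‖` is invariant since `max ‖a‖ ((κ + ε) * ‖a‖) = ‖a‖`; this yields the
    -- bound on the solution along with its existence.
    have hsub : closedBall (0 : X) ‖a‖ ⊆ ball 0 r := closedBall_subset_ball ha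
    have h0 : (0 : X) ∈ ball (0 : X) r := hsub (by simp)
    have hmaps : MapsTo (fun x => Λ (a, x, Φ x)) (closedBall 0 ‖a‖) (closedBall 0 ‖a‖) := by
      intro x hx
      have h1 := hlip x (hsub hx) 0 h0
      rw [hΦ0, sub_zero, sub_zero] at h1
      rw [mem_closedBall_zero_iff] at hx ⊢
      refine (hΛ a x (Φ x)).trans (max_le le_rfl ?_)
      nlinarith [norm_nonneg x]
    have hct : ContractingWith ⟨κ + ε, by positivity⟩ (hmaps.restrict _ _ _) := by
      refine ⟨by exact_mod_cast hκε, LipschitzWith.of_dist_le_mul fun x y => ?_⟩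
      rw [Subtype.dist_eq, Subtype.dist_eq, dist_eq_norm, dist_eq_norm]
      exact hcontr a x (hsub x.2) y (hsub y.2)
    obtain ⟨x, hx, hfix, -⟩ := hct.exists_fixedPoint' isClosed_closedBall.isComplete hmaps
      (x := 0) (by simp) (edist_ne_top _ _)
    exact ⟨x, by simpa using hx, hfix⟩
  choose! sol hsol_norm hsol using hex
  have hmem : ∀ a ∈ ball (0 : A) r, sol a ∈ ball (0 : X) r := by
    intro a ha
    have := hsol_norm a ha
    rw [mem_ball_zero_iff] at ha ⊢
    exact this.trans_lt ha
  refine ⟨sol, fun a ha => ContDiffAt.contDiffWithinAt ?_, fun a ha =>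
    ⟨hsol_norm a ha, hsol a ha, fun x hx h => huniq a x hx _ (hmem a ha) h (hsol a ha)⟩⟩
  have hΦa : ContDiffAt ℝ n Φ (sol a) := hΦ.contDiffAt (isOpen_ball.mem_nhds (hmem a ha))
  have hΦd : HasFDerivAt Φ (fderiv ℝ Φ (sol a)) (sol a) :=
    (hΦa.differentiableAt hn).hasFDerivAt
  have hΦn : ‖fderiv ℝ Φ (sol a)‖ ≤ ε := by
    refine hΦd.le_of_lip' hε ?_
    filter_upwards [isOpen_ball.mem_nhds (hmem a ha)] with x hx
    exact hlip x hx _ (hmem a ha)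
  -- `K` is the derivative of `x ↦ Λ (0, x, Φ x)` at the solution. Its norm is at most `κ + ε < 1`,
  -- so `1 - K` is invertible.
  set K : X →L[ℝ] X := Λ ∘L ((0 : X →L[ℝ] A).prod
    ((ContinuousLinearMap.id ℝ X).prod (fderiv ℝ Φ (sol a)))) with hK
  have hKn : ‖K‖ < 1 := by
    refine (ContinuousLinearMap.opNorm_le_bound K (by positivity) fun x => ?_).trans_lt hκε
    have h2 := hΛ 0 x (fderiv ℝ Φ (sol a) x)
    rw [norm_zero, max_eq_right (by positivity)] at h2
    have h3 := (fderiv ℝ Φ (sol a)).le_of_opNorm_le hΦn x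
    simp only [hK, ContinuousLinearMap.comp_apply, ContinuousLinearMap.prod_apply,
      zero_apply, ContinuousLinearMap.id_apply]
    linarith
  -- By linearity of `Λ` the parameter separates: the equation reads `G x = Λ (a, 0, 0)`, and the
  -- inverse function theorem for `G` suffices.
  let G : X → X := fun x => x - Λ (0, x, Φ x)
  let G' : X ≃L[ℝ] X := ContinuousLinearEquiv.ofUnit (Units.oneSub K hKn)
  have hGd : HasFDerivAt G (G' : X →L[ℝ] X) (sol a) := by
    have h1 : HasFDerivAt (fun x => ((0 : A), x, Φ x)) ((0 : X →L[ℝ] A).prod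
        ((ContinuousLinearMap.id ℝ X).prod (fderiv ℝ Φ (sol a)))) (sol a) :=
      (hasFDerivAt_const _ _).prodMk ((hasFDerivAt_id _).prodMk hΦd)
    exact (hasFDerivAt_id (sol a)).sub (Λ.hasFDerivAt.comp (sol a) h1)
  have hGc : ContDiffAt ℝ n G (sol a) :=
    contDiffAt_id.sub (Λ.contDiff.contDiffAt.comp (sol a)
      (contDiffAt_const.prodMk (contDiffAt_id.prodMk hΦa)))
  have hsplit : ∀ b x, Λ (b, x, Φ x) = Λ (b, 0, 0) + Λ (0, x, Φ x) := by
    intro b x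
    rw [← map_add]; simp
  have hGsol : ∀ b ∈ ball (0 : A) r, G (sol b) = Λ (b, 0, 0) := by
    intro b hb
    have := hsol b hb
    rw [hsplit] at this
    exact sub_eq_iff_eq_add.mpr this.symm
  have hinv := hGc.to_localInverse hGd hn
  have hPc : ContDiff ℝ n (fun b : A => Λ (b, 0, 0)) :=
    Λ.contDiff.comp (contDiff_id.prodMk contDiff_const)
  rw [hGsol a ha] at hinv
  refine (hinv.comp a hPc.contDiffAt).congr_of_eventuallyEq ?_
  have hstrict : HasStrictFDerivAt G (G' : X →L[ℝ] X) (sol a) :=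
    hGc.hasStrictFDerivAt' hGd hn
  have hright : ∀ᶠ b in 𝓝 a, G (hGc.localInverse hGd hn (Λ (b, 0, 0))) = Λ (b, 0, 0) := by
    have h := hstrict.eventually_right_inverse
    rw [hGsol a ha] at h
    exact (hPc.continuous.tendsto a).eventually h
  have hnear : ∀ᶠ b in 𝓝 a, hGc.localInverse hGd hn (Λ (b, 0, 0)) ∈ ball (0 : X) r := by
    refine (hinv.comp a hPc.contDiffAt).continuousAt.eventually (isOpen_ball.mem_nhds ?_)
    have := hGc.localInverse_apply_image hGd hn
    rw [hGsol a ha] at this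
    change hGc.localInverse hGd hn (Λ (a, 0, 0)) ∈ ball 0 r
    rw [this]
    exact hmem a ha
  -- The local inverse solves the same equation and stays in the ball, so by uniqueness it agrees
  -- with `sol` near `a`.
  filter_upwards [hright, hnear, isOpen_ball.mem_nhds ha] with b h1 h2 h3
  refine huniq b _ (hmem b h3) _ h2 (hsol b h3) ?_
  simp only [Function.comp_apply]
  rw [hsplit]
  exact (sub_eq_iff_eq_add.mp h1).symm

end FixedPoint

end HypFamily

namespace HypFamily

open BoundedContinuousFunction Metric

/-! ### Bounded solutions of the split recursion -/

section Orbits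

variable {E F : Type} [NormedAddCommGroup E] [NormedSpace ℝ E]
  [NormedAddCommGroup F] [NormedSpace ℝ F]

/-- The sequence `x` solves the split recursion whose first component is propagated forward
and whose second component is propagated backward. -/
def IsOrbit (S : ℕ → E →L[ℝ] E) (Q : ℕ → F →L[ℝ] F) (w : ℕ → E × F → E × F) (σ : ℕ)
    (x : ℕ → E × F) : Prop :=
  ∀ n, (x (n + 1)).1 = S n (x n).1 + (w (n + σ) (x (n + σ))).1 ∧
    (x n).2 = Q n (x (n + 1)).2 + (w (n + σ) (x (n + σ))).2

variable {S : ℕ → E →L[ℝ] E} {Q : ℕ → F →L[ℝ] F} {w : ℕ → E × F → E × F} {σ : ℕ}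
  {x : ℕ → E × F} {κ ε c : ℝ}

theorem IsOrbit.shift (hx : IsOrbit S Q w σ x) (k : ℕ) :
    IsOrbit (fun n => S (n + k)) (fun n => Q (n + k)) (fun n => w (n + k)) σ
      (fun n => x (n + k)) := by
  intro n
  have h := hx (n + k)
  rw [show n + k + 1 = n + 1 + k by omega, show n + k + σ = n + σ + k by omega] at h
  exact h

theorem IsOrbit.norm_fst_succ_le (hx : IsOrbit S Q w σ x) (hε : 0 ≤ ε)
    (hS : ∀ n, ‖S n‖ ≤ κ) (hw : ∀ n z, ‖z‖ ≤ 1 → ‖w n z‖ ≤ ε * ‖z‖)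
    (hx1 : ∀ n, ‖x n‖ ≤ 1) {M : ℝ} (hM : ∀ n, ‖x n‖ ≤ M) (n : ℕ) :
    ‖(x (n + 1)).1‖ ≤ (κ + ε) * M := by
  have hκ := (norm_nonneg _).trans (hS 0)
  rw [(hx n).1]
  have h1 := (S n).le_of_opNorm_le (hS n) (x n).1
  have h2 := (norm_fst_le (w (n + σ) (x (n + σ)))).trans (hw _ _ (hx1 _))
  have h3 := (norm_fst_le (x n)).trans (hM n)
  refine (norm_add_le _ _).trans ?_
  nlinarith [hM (n + σ)]

theorem IsOrbit.norm_snd_le_mul (hx : IsOrbit S Q w σ x) (hε : 0 ≤ ε)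
    (hQ : ∀ n, ‖Q n‖ ≤ κ) (hw : ∀ n z, ‖z‖ ≤ 1 → ‖w n z‖ ≤ ε * ‖z‖)
    (hx1 : ∀ n, ‖x n‖ ≤ 1) {M : ℝ} (hM : ∀ n, ‖x n‖ ≤ M) (n : ℕ) :
    ‖(x n).2‖ ≤ (κ + ε) * M := by
  have hκ := (norm_nonneg _).trans (hQ 0)
  rw [(hx n).2]
  have h1 := (Q n).le_of_opNorm_le (hQ n) (x (n + 1)).2
  have h2 := (norm_snd_le (w (n + σ) (x (n + σ)))).trans (hw _ _ (hx1 _))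
  have h3 := (norm_snd_le (x (n + 1))).trans (hM (n + 1))
  refine (norm_add_le _ _).trans ?_
  nlinarith [hM (n + σ)]

/-- A bounded solution is controlled by the first component of its initial value. -/
theorem IsOrbit.norm_le (hx : IsOrbit S Q w σ x) (hε : 0 ≤ ε) (hκε : κ + ε < 1)
    (hS : ∀ n, ‖S n‖ ≤ κ) (hQ : ∀ n, ‖Q n‖ ≤ κ) (hw : ∀ n z, ‖z‖ ≤ 1 → ‖w n z‖ ≤ ε * ‖z‖)
    (hx1 : ∀ n, ‖x n‖ ≤ 1) (n : ℕ) : ‖x n‖ ≤ ‖(x 0).1‖ := by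
  have hκ := (norm_nonneg _).trans (hS 0)
  have hM : ∀ n, ‖x n‖ ≤ ⨆ k, ‖x k‖ :=
    le_ciSup (f := fun k => ‖x k‖) ⟨1, by rintro _ ⟨k, rfl⟩; exact hx1 k⟩
  have hM0 : 0 ≤ ⨆ k, ‖x k‖ := (norm_nonneg _).trans (hM 0)
  have hle : (⨆ k, ‖x k‖) ≤ max ‖(x 0).1‖ ((κ + ε) * ⨆ k, ‖x k‖) := by
    refine ciSup_le fun k => ?_
    rw [Prod.norm_def]
    refine max_le ?_ ((hx.norm_snd_le_mul hε hQ hw hx1 hM k).trans (le_max_right _ _))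
    cases k with
    | zero => exact le_max_left _ _
    | succ k => exact (hx.norm_fst_succ_le hε hS hw hx1 hM k).trans (le_max_right _ _)
  refine (hM n).trans ?_
  -- If the supremum is at most `κ + ε` times itself, it vanishes.
  rcases le_max_iff.mp hle with h | h
  · exact h
  · nlinarith [norm_nonneg (x 0).1]

theorem IsOrbit.norm_snd_zero_le (hx : IsOrbit S Q w σ x) (hε : 0 ≤ ε) (hκε : κ + ε < 1)
    (hS : ∀ n, ‖S n‖ ≤ κ) (hQ : ∀ n, ‖Q n‖ ≤ κ) (hw : ∀ n z, ‖z‖ ≤ 1 → ‖w n z‖ ≤ ε * ‖z‖)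
    (hx1 : ∀ n, ‖x n‖ ≤ 1) : ‖(x 0).2‖ ≤ (κ + ε) * ‖(x 0).1‖ :=
  hx.norm_snd_le_mul hε hQ hw hx1 (hx.norm_le hε hκε hS hQ hw hx1) 0

/-- A tail of a solution solves the shifted recursion, so it is dominated by its own initial first
component; each step shrinks that component by the factor `κ + ε`. -/
theorem IsOrbit.tendsto_zero (hx : IsOrbit S Q w σ x) (hε : 0 ≤ ε) (hκε : κ + ε < 1)
    (hS : ∀ n, ‖S n‖ ≤ κ) (hQ : ∀ n, ‖Q n‖ ≤ κ) (hw : ∀ n z, ‖z‖ ≤ 1 → ‖w n z‖ ≤ ε * ‖z‖)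
    (hx1 : ∀ n, ‖x n‖ ≤ 1) : Tendsto x atTop (𝓝 0) := by
  have hκ := (norm_nonneg _).trans (hS 0)
  have hshift : ∀ k n, ‖x (n + k)‖ ≤ ‖(x k).1‖ := fun k n => by
    simpa using (hx.shift k).norm_le hε hκε (fun n => hS _) (fun n => hQ _) (fun n => hw _)
      (fun n => hx1 _) n
  have hdecay : ∀ n, ‖(x n).1‖ ≤ (κ + ε) ^ n := by
    intro n
    induction n with
    | zero => simpa using (norm_fst_le _).trans (hx1 0)
    | succ n ih =>
      have h := (hx.shift n).norm_fst_succ_le hε (fun n => hS _) (fun n => hw _)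
        (fun n => hx1 _) (hshift n) 0
      simp only [zero_add, add_comm 1 n] at h
      rw [pow_succ']
      exact h.trans (by gcongr)
  refine squeeze_zero_norm (fun n => ?_) (tendsto_pow_atTop_nhds_zero_of_lt_one
    (by positivity) hκε)
  have := hshift n 0
  rw [zero_add] at this
  exact this.trans (hdecay n)

/-- The second components satisfy a backward contraction of rate `κ` with forcing at most `c * ‖(x
0).1‖ ^ 2`. This quadratic bound is what makes the graphs tangent to the coordinate planes at `0`.
-/
theorem IsOrbit.norm_snd_le_sq (hx : IsOrbit S Q w σ x) (hc : 0 ≤ c) (hκ1 : κ < 1)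
    (hQ : ∀ n, ‖Q n‖ ≤ κ) (hw : ∀ n z, ‖z‖ ≤ 1 → ‖w n z‖ ≤ c * ‖z‖ ^ 2)
    (hx1 : ∀ n, ‖x n‖ ≤ 1) (hx0 : ∀ n, ‖x n‖ ≤ ‖(x 0).1‖) :
    ‖(x 0).2‖ ≤ c / (1 - κ) * ‖(x 0).1‖ ^ 2 := by
  have hκ := (norm_nonneg _).trans (hQ 0)
  have hM : ∀ n, ‖(x n).2‖ ≤ ⨆ k, ‖(x k).2‖ :=
    le_ciSup (f := fun k => ‖(x k).2‖)
      ⟨1, by rintro _ ⟨k, rfl⟩; exact (norm_snd_le _).trans (hx1 k)⟩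
  have hle : (⨆ k, ‖(x k).2‖) ≤ κ * (⨆ k, ‖(x k).2‖) + c * ‖(x 0).1‖ ^ 2 := by
    refine ciSup_le fun n => ?_
    rw [(hx n).2]
    refine (norm_add_le _ _).trans (add_le_add ?_ ?_)
    · exact ((Q n).le_of_opNorm_le (hQ n) _).trans (by gcongr; exact hM _)
    · exact ((norm_snd_le _).trans (hw _ _ (hx1 _))).trans (by gcongr; exact hx0 _)
  refine (hM 0).trans ?_
  rw [div_mul_eq_mul_div, le_div_iff₀ (by linarith)]
  linarith

/-- The linear part of the split recursion, on families of sequences. -/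
theorem exists_recursionMap {κ : ℝ} (hκ : 0 ≤ κ) (S : ℤ × ℕ → E →L[ℝ] E)
    (Q : ℤ × ℕ → F →L[ℝ] F) (hS : ∀ i, ‖S i‖ ≤ κ) (hQ : ∀ i, ‖Q i‖ ≤ κ) (σ : ℕ) :
    ∃ Λ : E × ((ℤ × ℕ) →ᵇ E × F) × ((ℤ × ℕ) →ᵇ E × F) →L[ℝ] ((ℤ × ℕ) →ᵇ E × F),
      (∀ a x y, ‖Λ (a, x, y)‖ ≤ max ‖a‖ (κ * ‖x‖ + ‖y‖)) ∧
      (∀ a x y m, (Λ (a, x, y) (m, 0)).1 = a) ∧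
      (∀ a x y m n, (Λ (a, x, y) (m, n + 1)).1 = S (m, n) (x (m, n)).1 + (y (m, n + σ)).1) ∧
      (∀ a x y m n, (Λ (a, x, y) (m, n)).2 = Q (m, n) (x (m, n + 1)).2 + (y (m, n + σ)).2) := by
  -- At time `0` the first component is the prescribed `a`, the same for every `m`.
  let fst : E → ((ℤ × ℕ) →ᵇ E × F) → ((ℤ × ℕ) →ᵇ E × F) → ℤ → ℕ → E := fun a x y m n =>
    Nat.rec a (fun n _ => S (m, n) (x (m, n)).1 + (y (m, n + σ)).1) n
  let snd : ((ℤ × ℕ) →ᵇ E × F) → ((ℤ × ℕ) →ᵇ E × F) → ℤ → ℕ → F := fun x y m n =>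
    Q (m, n) (x (m, n + 1)).2 + (y (m, n + σ)).2
  have hbound : ∀ a x y (i : ℤ × ℕ),
      ‖(fst a x y i.1 i.2, snd x y i.1 i.2)‖ ≤ max ‖a‖ (κ * ‖x‖ + ‖y‖) := by
    rintro a x y ⟨m, n⟩
    rw [Prod.norm_def]
    refine max_le ?_ (le_max_of_le_right ?_)
    · cases n with
      | zero => exact le_max_left _ _
      | succ n =>
        refine le_max_of_le_right ((norm_add_le _ _).trans (add_le_add ?_ ?_))
        · exact ((S _).le_of_opNorm_le (hS _) _).trans (mul_le_mul_of_nonneg_left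
            ((norm_fst_le _).trans (x.norm_coe_le_norm _)) hκ)
        · exact (norm_fst_le _).trans (y.norm_coe_le_norm _)
    · refine (norm_add_le _ _).trans (add_le_add ?_ ?_)
      · exact ((Q _).le_of_opNorm_le (hQ _) _).trans (mul_le_mul_of_nonneg_left
          ((norm_snd_le _).trans (x.norm_coe_le_norm _)) hκ)
      · exact (norm_snd_le _).trans (y.norm_coe_le_norm _)
  let L : E × ((ℤ × ℕ) →ᵇ E × F) × ((ℤ × ℕ) →ᵇ E × F) →ₗ[ℝ] ((ℤ × ℕ) →ᵇ E × F) :=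
    { toFun := fun p => ofNormedAddCommGroupDiscrete
        (fun i : ℤ × ℕ => (fst p.1 p.2.1 p.2.2 i.1 i.2, snd p.2.1 p.2.2 i.1 i.2)) _
        (hbound p.1 p.2.1 p.2.2)
      map_add' := by
        rintro ⟨a, x, y⟩ ⟨a', x', y'⟩
        ext ⟨m, n⟩
        · cases n with
          | zero => rfl
          | succ n => simp [fst]; abel
        · simp [snd]; abel
      map_smul' := by
        rintro k ⟨a, x, y⟩
        ext ⟨m, n⟩
        · cases n with
          | zero => rfl
          | succ n => simp [fst]
        · simp [snd] }
  have hL : ∀ a x y, ‖L (a, x, y)‖ ≤ max ‖a‖ (κ * ‖x‖ + ‖y‖) := fun a x y =>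
    (BoundedContinuousFunction.norm_le (le_max_of_le_left (norm_nonneg _))).mpr (hbound a x y)
  refine ⟨L.mkContinuous (κ + 1) ?_, hL, fun a x y m => rfl, fun a x y m n => rfl,
    fun a x y m n => rfl⟩
  rintro ⟨a, x, y⟩
  have h1 : ‖a‖ ≤ ‖(a, x, y)‖ := norm_fst_le (a, x, y)
  have h2 : ‖x‖ ≤ ‖(a, x, y)‖ := (norm_fst_le (x, y)).trans (norm_snd_le (a, x, y))
  have h3 : ‖y‖ ≤ ‖(a, x, y)‖ := (norm_snd_le (x, y)).trans (norm_snd_le (a, x, y))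
  refine (hL a x y).trans (max_le ?_ ?_) <;> nlinarith [norm_nonneg (a, x, y)]

end Orbits

/-! ### Graphs of initial values -/

theorem unitBall_eq (n : ℕ) : unitBall n = closedBall 0 1 := by
  ext x; simp [unitBall]

theorem uniqueDiffOn_unitBall (n : ℕ) : UniqueDiffOn ℝ (unitBall n) := by
  rw [unitBall_eq]
  refine uniqueDiffOn_convex (convex_closedBall _ _) ⟨0, ?_⟩
  exact ball_subset_interior_closedBall (by simp)

/-- For each initial first component there is a unique bounded solution of the split recursion,
and the second component of its initial value depends smoothly on the first. -/
theorem exists_graphFamily {a b N : ℕ} (hN : 1 ≤ N) {κ ε c r : ℝ} (hκ : 0 ≤ κ) (hε : 0 ≤ ε)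
    (hκε : κ + ε < 1) (hc : 0 ≤ c) (hr : 1 < r)
    {S : ℤ × ℕ → Euc a →L[ℝ] Euc a} {Q : ℤ × ℕ → Euc b →L[ℝ] Euc b}
    {w : ℤ × ℕ → Euc a × Euc b → Euc a × Euc b} (σ : ℕ)
    (hS : ∀ i, ‖S i‖ ≤ κ) (hQ : ∀ i, ‖Q i‖ ≤ κ)
    (hw : UniformlySmoothOn (N + 1) w (ball 0 r)) (hw0 : ∀ i, w i 0 = 0)
    (hlip : ∀ i, ∀ x ∈ ball (0 : Euc a × Euc b) r, ∀ y ∈ ball (0 : Euc a × Euc b) r,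
      ‖w i x - w i y‖ ≤ ε * ‖x - y‖)
    (hquad : ∀ i, ∀ x ∈ ball (0 : Euc a × Euc b) r, ‖w i x‖ ≤ c * ‖x‖ ^ 2) :
    ∃ F : ℤ → Euc a → Euc b, IsGraphFamily N F ∧ ∀ (m : ℤ) (p : Euc a × Euc b),
      (‖p.1‖ ≤ 1 ∧ p.2 = F m p.1) ↔
        ∃ x : ℕ → Euc a × Euc b, IsOrbit (fun n => S (m, n)) (fun n => Q (m, n))
          (fun n => w (m, n)) σ x ∧ x 0 = p ∧ ∀ n, ‖x n‖ ≤ 1 := by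
  obtain ⟨Λ, hΛ, hΛ0, hΛ1, hΛ2⟩ := exists_recursionMap hκ S Q hS hQ σ
  have happ : ∀ x ∈ ball (0 : (ℤ × ℕ) →ᵇ Euc a × Euc b) r, ∀ i, superposition w x i = w i (x i) :=
    fun x hx i => hw.superposition_apply hx i
  have hr0 : (0 : (ℤ × ℕ) →ᵇ Euc a × Euc b) ∈ ball (0 : (ℤ × ℕ) →ᵇ Euc a × Euc b) r :=
    mem_ball_self (by linarith)
  have hΦlip : ∀ x ∈ ball (0 : (ℤ × ℕ) →ᵇ Euc a × Euc b) r,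
      ∀ y ∈ ball (0 : (ℤ × ℕ) →ᵇ Euc a × Euc b) r,
      ‖superposition w x - superposition w y‖ ≤ ε * ‖x - y‖ := by
    intro x hx y hy
    refine (BoundedContinuousFunction.norm_le (by positivity)).mpr fun i => ?_
    rw [BoundedContinuousFunction.coe_sub, Pi.sub_apply, happ x hx, happ y hy]
    exact (hlip i _ (apply_mem_ball hx i) _ (apply_mem_ball hy i)).trans
      (mul_le_mul_of_nonneg_left ((x - y).norm_coe_le_norm i) hε)
  have hΦ0 : superposition w (0 : (ℤ × ℕ) →ᵇ Euc a × Euc b) = 0 := by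
    ext1 i
    rw [happ 0 hr0]
    exact hw0 i
  obtain ⟨sol, hsmooth, hsol⟩ := exists_solution (n := N) (by exact_mod_cast (by omega : N ≠ 0))
    hκ hε hκε Λ hΛ (contDiffOn_superposition hw) hΦ0 hΦlip
  have horbit : ∀ p, ∀ x ∈ ball (0 : (ℤ × ℕ) →ᵇ Euc a × Euc b) r,
      Λ (p, x, superposition w x) = x ↔ ∀ m, (x (m, 0)).1 = p ∧
        IsOrbit (fun n => S (m, n)) (fun n => Q (m, n)) (fun n => w (m, n)) σ
          (fun n => x (m, n)) := by
    intro p x hx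
    constructor
    · intro h m
      refine ⟨by rw [← h]; exact hΛ0 .., fun n => ⟨?_, ?_⟩⟩
      · have := hΛ1 p x (superposition w x) m n
        rwa [h, happ x hx] at this
      · have := hΛ2 p x (superposition w x) m n
        rwa [h, happ x hx] at this
    · intro h
      ext1 ⟨m, n⟩
      refine Prod.ext ?_ ?_
      · cases n with
        | zero => rw [hΛ0]; exact (h m).1.symm
        | succ n => rw [hΛ1, happ x hx]; exact ((h m).2 n).1.symm
      · rw [hΛ2, happ x hx]; exact ((h m).2 n).2.symm
  have hball : ∀ p : Euc a, ‖p‖ ≤ 1 → p ∈ ball (0 : Euc a) r := fun p hp => by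
    rw [mem_ball_zero_iff]; linarith
  have hsolr : ∀ p : Euc a, ‖p‖ ≤ 1 → sol p ∈ ball (0 : (ℤ × ℕ) →ᵇ Euc a × Euc b) r :=
    fun p hp => by
      have := (hsol p (hball p hp)).1
      rw [mem_ball_zero_iff]; linarith
  have hsolo : ∀ p : Euc a, ‖p‖ ≤ 1 → ∀ m, (sol p (m, 0)).1 = p ∧
      IsOrbit (fun n => S (m, n)) (fun n => Q (m, n)) (fun n => w (m, n)) σ
        (fun n => sol p (m, n)) := fun p hp =>
    (horbit p _ (hsolr p hp)).mp (hsol p (hball p hp)).2.1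
  have hsoln : ∀ p : Euc a, ‖p‖ ≤ 1 → ∀ i, ‖sol p i‖ ≤ ‖p‖ := fun p hp i =>
    ((sol p).norm_coe_le_norm i).trans (hsol p (hball p hp)).1
  let P : ℤ → ((ℤ × ℕ) →ᵇ Euc a × Euc b) →L[ℝ] Euc b := fun m =>
    (ContinuousLinearMap.snd ℝ (Euc a) (Euc b)) ∘L (evalCLM ℝ (m, 0))
  have hP : ∀ m, ‖P m‖ ≤ 1 := fun m =>
    (P m).opNorm_le_bound zero_le_one fun x => by
      rw [one_mul]
      exact (norm_snd_le _).trans (x.norm_coe_le_norm _)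
  have hsub : unitBall a ⊆ ball (0 : Euc a) r := fun p hp => hball p hp
  have hsolU : ContDiffOn ℝ N sol (unitBall a) := hsmooth.mono hsub
  have hb : ∀ p : Euc a, ‖p‖ ≤ 1 → ∀ m, ‖P m (sol p)‖ ≤ ‖p‖ := fun p hp m =>
    (norm_snd_le _).trans (hsoln p hp (m, 0))
  refine ⟨fun m => P m ∘ sol, ⟨fun m p hp => (hb p hp m).trans hp,
    fun m => (P m).contDiff.comp_contDiffOn hsolU, fun m => ?_, fun m => ?_, ?_⟩, fun m p => ?_⟩
  · have := hb 0 (by simp) m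
    rw [norm_zero] at this
    exact norm_le_zero_iff.mp this
  · refine Asymptotics.IsBigO.hasFDerivAt (n := 2) ?_ one_lt_two
    refine Asymptotics.IsBigO.of_bound (c / (1 - κ)) ?_
    filter_upwards [closedBall_mem_nhds (0 : Euc a) one_pos] with p hp
    rw [mem_closedBall_zero_iff] at hp
    have h := (hsolo p hp m).2.norm_snd_le_sq hc (by linarith) (fun n => hQ _)
      (fun n z hz => hquad _ z (by rw [mem_ball_zero_iff]; linarith))
      (fun n => (hsoln p hp _).trans hp)
      (fun n => by rw [(hsolo p hp m).1]; exact hsoln p hp _)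
    rw [(hsolo p hp m).1] at h
    simpa [P] using h
  -- The derivatives of the single map `sol` are bounded on the compact unit ball, and `‖P m‖ ≤ 1`;
  -- hence the bounds do not depend on `m`.
  · have hk : ∀ k ∈ Finset.range (N + 1), ∃ C : ℝ, ∀ p ∈ unitBall a,
        ‖iteratedFDerivWithin ℝ k sol (unitBall a) p‖ ≤ C := by
      intro k hk
      have hkN : k ≤ N := by simpa [Nat.lt_succ_iff] using hk
      refine IsCompact.exists_bound_of_continuousOn ?_
        (hsolU.continuousOn_iteratedFDerivWithin (by exact_mod_cast hkN) (uniqueDiffOn_unitBall a))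
      rw [unitBall_eq]
      exact isCompact_closedBall _ _
    choose! C hC using hk
    refine ⟨∑ k ∈ Finset.range (N + 1), |C k|, fun m k hkN p hp => ?_⟩
    have hkr : k ∈ Finset.range (N + 1) := by simpa [Nat.lt_succ_iff] using hkN
    calc ‖iteratedFDerivWithin ℝ k (P m ∘ sol) (unitBall a) p‖
        ≤ ‖P m‖ * ‖iteratedFDerivWithin ℝ k sol (unitBall a) p‖ :=
          (P m).norm_iteratedFDerivWithin_comp_left (hsolU p hp) (uniqueDiffOn_unitBall a) hp
            (by exact_mod_cast hkN)
      _ ≤ 1 * |C k| := by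
          gcongr
          · exact hP m
          · exact (hC k hkr p hp).trans (le_abs_self _)
      _ ≤ ∑ k ∈ Finset.range (N + 1), |C k| := by
          rw [one_mul]
          exact Finset.single_le_sum (f := fun k => |C k|) (fun _ _ => abs_nonneg _) hkr
  · constructor
    · rintro ⟨hp, hpF⟩
      refine ⟨fun n => sol p.1 (m, n), (hsolo _ hp m).2, Prod.ext (hsolo _ hp m).1 hpF.symm,
        fun n => (hsoln _ hp _).trans hp⟩
    · rintro ⟨x, hx, rfl, hx1⟩
      have hp : ‖(x 0).1‖ ≤ 1 := (norm_fst_le _).trans (hx1 0)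
      refine ⟨hp, ?_⟩
      -- Uniqueness concerns families over all starting times, so the given orbit at `m` is
      -- completed by `sol` at all others.
      let y : (ℤ × ℕ) →ᵇ Euc a × Euc b := ofNormedAddCommGroupDiscrete
        (fun i : ℤ × ℕ => if i.1 = m then x i.2 else sol (x 0).1 i) 1 (fun i => by
          split_ifs
          · exact hx1 _
          · exact (hsoln _ hp _).trans hp)
      have hym : ∀ n, y (m, n) = x n := fun n => if_pos rfl
      have hyr : y ∈ ball (0 : (ℤ × ℕ) →ᵇ Euc a × Euc b) r := by
        rw [mem_ball_zero_iff]
        exact (norm_ofNormedAddCommGroup_le _ zero_le_one _).trans_lt hr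
      have hyo : Λ ((x 0).1, y, superposition w y) = y := by
        refine (horbit _ _ hyr).mpr fun m' => ?_
        by_cases hm : m' = m
        · subst hm
          simp only [hym]
          exact ⟨trivial, hx⟩
        · have hym' : ∀ n, y (m', n) = sol (x 0).1 (m', n) := fun n => if_neg hm
          simp only [hym']
          exact hsolo _ hp m'
      have := (hsol _ (hball _ hp)).2.2 y hyr hyo
      change (x 0).2 = (sol (x 0).1 (m, 0)).2
      rw [← this, hym]

end HypFamily

namespace HypFamily

open Metric

/-! ### Hyperbolic linear part and small remainder -/

section Remainder

variable {ι κ : Type*} {E F G H : Type} [NormedAddCommGroup E] [NormedSpace ℝ E]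
  [NormedAddCommGroup F] [NormedSpace ℝ F] [NormedAddCommGroup G] [NormedSpace ℝ G]
  [NormedAddCommGroup H] [NormedSpace ℝ H]

/-- A family of smooth functions on the ball of radius `r` that are quadratically small at `0`
and have Lipschitz constant `ε`. -/
structure IsRemainder (n : ℕ) (ε c r : ℝ) (f : ι → E → F) : Prop where
  smooth : UniformlySmoothOn n f (ball 0 r)
  map_zero : ∀ i, f i 0 = 0
  lipschitz : ∀ i, ∀ x ∈ ball (0 : E) r, ∀ y ∈ ball (0 : E) r, ‖f i x - f i y‖ ≤ ε * ‖x - y‖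
  quadratic : ∀ i, ∀ x ∈ ball (0 : E) r, ‖f i x‖ ≤ c * ‖x‖ ^ 2

/-- The nonlinearities of both recursions arise from the remainders in this way: reindex time,
possibly swap the factors, and apply an operator of norm at most `1`. No constant gets worse. -/
theorem IsRemainder.comp {n : ℕ} {ε c r : ℝ} {f : κ → E → F} (hf : IsRemainder n ε c r f)
    {T : ι → F →L[ℝ] G} (hT : ∀ i, ‖T i‖ ≤ 1) (t : ι → κ) (g : H ≃ₗᵢ[ℝ] E) :
    IsRemainder n ε c r (fun i z => T i (f (t i) (g z))) := by
  have hmaps : ∀ z ∈ ball (0 : H) r, g z ∈ ball (0 : E) r := fun z hz => by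
    rw [mem_ball_zero_iff] at hz ⊢
    rwa [g.norm_map]
  have hle : ∀ i z, ‖T i z‖ ≤ ‖z‖ := fun i z => by
    simpa using (T i).le_of_opNorm_le (hT i) z
  refine ⟨⟨fun i => (T i).contDiff.comp_contDiffOn ((hf.smooth.contDiffOn (t i)).comp
    g.contDiff.contDiffOn hmaps), ?_⟩, fun i => ?_, fun i x hx y hy => ?_, fun i x hx => ?_⟩
  · obtain ⟨C, hC⟩ := hf.smooth.bounded
    refine ⟨C, fun k hk i z hz => ?_⟩
    have h1 : ContDiffAt ℝ n (f (t i) ∘ g) z :=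
      ((hf.smooth.contDiffOn (t i)).contDiffAt (isOpen_ball.mem_nhds (hmaps z hz))).comp z
        g.contDiff.contDiffAt
    have h2 := (T i).norm_iteratedFDeriv_comp_left h1 (n := k) (by exact_mod_cast hk)
    rw [g.norm_iteratedFDeriv_comp_right] at h2
    have h3 := hC k hk (t i) _ (hmaps z hz)
    exact h2.trans ((mul_le_of_le_one_left (norm_nonneg _) (hT i)).trans h3)
  · simp [hf.map_zero]
  · rw [← map_sub]
    refine (hle _ _).trans ((hf.lipschitz _ _ (hmaps x hx) _ (hmaps y hy)).trans_eq ?_)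
    rw [← map_sub, g.norm_map]
  · refine (hle _ _).trans ((hf.quadratic _ _ (hmaps x hx)).trans_eq ?_)
    rw [g.norm_map]

theorem iteratedFDeriv_continuousLinearMap_eq_zero (L : E →L[ℝ] F) {k : ℕ} (hk : 2 ≤ k) (x : E) :
    iteratedFDeriv ℝ k L x = 0 := by
  obtain ⟨k, rfl⟩ := Nat.exists_eq_add_of_le' hk
  rw [← norm_eq_zero, show k + 2 = k + 1 + 1 from rfl, ← norm_iteratedFDeriv_fderiv,
    show fderiv ℝ (L : E → F) = fun _ => L from funext fun _ => L.fderiv,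
    iteratedFDeriv_const_of_ne (by omega)]
  simp

/-- The nonlinear parts of maps with small second derivatives. -/
theorem isRemainder_sub {n : ℕ} {K r : ℝ} (hK : 0 ≤ K) (hr : 0 < r) (hr2 : r ≤ 2)
    {f : ι → E → F} {L : ι → E →L[ℝ] F} (hf : ∀ i, ContDiffOn ℝ (n + 2 : ℕ) (f i) (ball 0 r))
    (h2 : ∀ i, ∀ x ∈ ball (0 : E) r, ‖iteratedFDeriv ℝ 2 (f i) x‖ ≤ K)
    (hbdd : ∃ C : ℝ, ∀ k, 2 ≤ k → k ≤ n + 2 → ∀ i, ∀ x ∈ ball (0 : E) r,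
      ‖iteratedFDeriv ℝ k (f i) x‖ ≤ C)
    (hf0 : ∀ i, f i 0 = 0) (hL : ∀ i, HasFDerivAt (f i) (L i) 0) :
    IsRemainder (n + 2) (2 * K) K r (fun i x => f i x - L i x) := by
  have h0 : (0 : E) ∈ ball (0 : E) r := mem_ball_self hr
  have hat : ∀ i, ∀ x ∈ ball (0 : E) r, ContDiffAt ℝ (n + 2 : ℕ) (f i) x := fun i x hx =>
    (hf i).contDiffAt (isOpen_ball.mem_nhds hx)
  have hd : ∀ i, ∀ x ∈ ball (0 : E) r, HasFDerivAt (fun x => f i x - L i x)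
      (fderiv ℝ (f i) x - L i) x := fun i x hx =>
    ((hat i x hx).differentiableAt (by simp)).hasFDerivAt.sub (L i).hasFDerivAt
  have hder : ∀ i, ∀ x ∈ ball (0 : E) r, ‖fderiv ℝ (f i) x - L i‖ ≤ K * ‖x‖ := by
    intro i x hx
    have hc : ContDiffOn ℝ 1 (fderiv ℝ (f i)) (ball 0 r) :=
      (hf i).fderiv_of_isOpen isOpen_ball (by norm_cast; omega)
    have := (convex_ball (0 : E) r).norm_image_sub_le_of_norm_fderiv_le (𝕜 := ℝ)
      (f := fderiv ℝ (f i)) (C := K)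
      (fun z hz => (hc.contDiffAt (isOpen_ball.mem_nhds hz)).differentiableAt (by simp))
      (fun z hz => by
        rw [← norm_iteratedFDeriv_one, norm_iteratedFDeriv_fderiv]
        exact h2 i z hz) h0 hx
    rwa [(hL i).fderiv, sub_zero] at this
  have hder2 : ∀ i, ∀ x ∈ ball (0 : E) r, ‖fderiv ℝ (f i) x - L i‖ ≤ 2 * K := by
    intro i x hx
    have := hder i x hx
    rw [mem_ball_zero_iff] at hx
    nlinarith
  have hquad : ∀ i, ∀ x ∈ ball (0 : E) r, ‖f i x - L i x‖ ≤ K * ‖x‖ ^ 2 := by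
    intro i x hx
    have hsub : closedBall (0 : E) ‖x‖ ⊆ ball 0 r :=
      closedBall_subset_ball (mem_ball_zero_iff.mp hx)
    have := (convex_closedBall (0 : E) ‖x‖).norm_image_sub_le_of_norm_hasFDerivWithin_le (𝕜 := ℝ)
      (f := fun x => f i x - L i x) (C := K * ‖x‖)
      (fun z hz => (hd i z (hsub hz)).hasFDerivWithinAt)
      (fun z hz => (hder i z (hsub hz)).trans
        (mul_le_mul_of_nonneg_left (mem_closedBall_zero_iff.mp hz) hK))
      (mem_closedBall_self (norm_nonneg x)) (mem_closedBall_zero_iff.mpr le_rfl)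
    simpa [hf0, sq, mul_assoc] using this
  refine ⟨⟨fun i => (hf i).sub (L i).contDiff.contDiffOn, ?_⟩, fun i => by simp [hf0],
    fun i x hx y hy => ?_, hquad⟩
  · obtain ⟨C, hC⟩ := hbdd
    refine ⟨max (K * 4) (max (2 * K) C), fun k hk i x hx => ?_⟩
    rcases k with _ | _ | k
    · rw [norm_iteratedFDeriv_zero]
      refine ((hquad i x hx).trans ?_).trans (le_max_left _ _)
      rw [mem_ball_zero_iff] at hx
      gcongr
      nlinarith [norm_nonneg x]
    · rw [zero_add, norm_iteratedFDeriv_one, (hd i x hx).fderiv]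
      exact (hder2 i x hx).trans ((le_max_left _ _).trans (le_max_right _ _))
    · have := iteratedFDeriv_sub_apply (𝕜 := ℝ) (i := k + 1 + 1) (f := f i) (g := L i) (x := x)
        ((hat i x hx).of_le (by exact_mod_cast hk)) (L i).contDiff.contDiffAt
      rw [iteratedFDeriv_continuousLinearMap_eq_zero _ (by omega), sub_zero] at this
      change ‖iteratedFDeriv ℝ (k + 1 + 1) (f i - ⇑(L i)) x‖ ≤ _
      rw [this]
      exact (hC _ (by omega) hk i x hx).trans ((le_max_right _ _).trans (le_max_right _ _))
  · exact (convex_ball (0 : E) r).norm_image_sub_le_of_norm_hasFDerivWithin_le (𝕜 := ℝ)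
      (f := fun x => f i x - L i x) (fun z hz => (hd i z hz).hasFDerivWithinAt) (hder2 i) hy hx

end Remainder

variable {du ds : ℕ}

theorem norm_le_eucNorm (x : Space du ds) : ‖x‖ ≤ eucNorm x := by
  rw [eucNorm, WithLp.prod_norm_eq_of_L2, Prod.norm_def]
  refine max_le ?_ ?_ <;> refine Real.le_sqrt_of_sq_le ?_ <;> simp

/-- The coordinates of a vector with respect to `coordVec`. -/
noncomputable def coord (v : Space du ds) : Fin du ⊕ Fin ds → ℝ :=
  Sum.elim (fun i => v.1 i) (fun i => v.2 i)

theorem abs_coord_le (v : Space du ds) (j : Fin du ⊕ Fin ds) : |coord v j| ≤ ‖v‖ := by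
  rcases j with j | j
  · exact (PiLp.norm_apply_le v.1 j).trans (norm_fst_le v)
  · exact (PiLp.norm_apply_le v.2 j).trans (norm_snd_le v)

theorem sum_coord_smul (v : Space du ds) : ∑ j, coord v j • coordVec du ds j = v := by
  rw [Fintype.sum_sum_type]
  ext i
  · simp [coord, coordVec, Prod.fst_sum, Pi.single_apply]
  · simp [coord, coordVec, Prod.snd_sum, Pi.single_apply]

/-- Expand every argument in the coordinate vectors: there are `(du + ds) ^ k` terms, with
coefficients at most `∏ i, ‖v i‖`. -/
theorem norm_iteratedFDeriv_le {k : ℕ} {f : Space du ds → Space du ds} {x : Space du ds} {δ : ℝ}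
    (hδ : 0 ≤ δ) (h : ∀ j : Fin k → Fin du ⊕ Fin ds, eucNorm (partialDeriv f j x) ≤ δ) :
    ‖iteratedFDeriv ℝ k f x‖ ≤ ((du + ds : ℕ) : ℝ) ^ k * δ := by
  refine ContinuousMultilinearMap.opNorm_le_bound (by positivity) fun v => ?_
  have hsum : iteratedFDeriv ℝ k f x v = ∑ j : Fin k → Fin du ⊕ Fin ds,
      (∏ i, coord (v i) (j i)) • partialDeriv f j x := by
    have h1 := (iteratedFDeriv ℝ k f x).toMultilinearMap.map_sum
      (fun i j => coord (v i) j • coordVec du ds j)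
    simp only [sum_coord_smul] at h1
    refine h1.trans (Finset.sum_congr rfl fun j _ => ?_)
    exact (iteratedFDeriv ℝ k f x).toMultilinearMap.map_smul_univ _ _
  rw [hsum]
  refine (norm_sum_le _ _).trans ?_
  have hterm : ∀ j ∈ (Finset.univ : Finset (Fin k → Fin du ⊕ Fin ds)),
      ‖(∏ i, coord (v i) (j i)) • partialDeriv f j x‖ ≤ (∏ i, ‖v i‖) * δ := by
    intro j _
    rw [norm_smul, Real.norm_eq_abs, Finset.abs_prod]
    gcongr with i
    · exact abs_coord_le _ _
    · exact (norm_le_eucNorm _).trans (h j)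
  refine (Finset.sum_le_card_nsmul _ _ _ hterm).trans_eq ?_
  rw [nsmul_eq_mul, Finset.card_univ, Fintype.card_fun, Fintype.card_sum, Fintype.card_fin,
    Fintype.card_fin, Fintype.card_fin]
  push_cast
  ring

theorem mem_unitBox {x : Space du ds} : x ∈ unitBox du ds ↔ ‖x‖ ≤ 1 := Iff.rfl

/-- The maps split into a hyperbolic linear part and a small remainder. -/
theorem IsHyperbolic.exists_splitting {N : ℕ} {lam μ C₀ δ : ℝ} {U V : Set (Space du ds)}
    {φ : ℤ → OpenPartialHomeomorph (Space du ds) (Space du ds)}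
    (h : IsHyperbolic N lam μ C₀ δ U V φ) (hN : 1 ≤ N) (hδ : 0 ≤ δ) :
    ∃ (r : ℝ) (A₁ : ℤ → Euc du ≃L[ℝ] Euc du) (A₂ : ℤ → Euc ds ≃L[ℝ] Euc ds)
      (f : ℤ → Space du ds → Space du ds), 1 < r ∧
      (∀ m, ‖((A₁ m).symm : Euc du →L[ℝ] Euc du)‖ ≤ μ⁻¹) ∧
      (∀ m, ‖(A₂ m : Euc ds →L[ℝ] Euc ds)‖ ≤ lam) ∧
      (∀ m x, φ m x = (A₁ m x.1 + (f m x).1, A₂ m x.2 + (f m x).2)) ∧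
      IsRemainder (N + 1) (2 * (((du + ds : ℕ) : ℝ) ^ 2 * δ)) (((du + ds : ℕ) : ℝ) ^ 2 * δ) r f := by
  have hU : IsOpen U := h.source_eq 0 ▸ (φ 0).open_source
  have hbox : closedBall (0 : Space du ds) 1 ⊆ U := fun x hx =>
    (h.box_subset (mem_unitBox.mpr (mem_closedBall_zero_iff.mp hx))).1
  -- Compactness of the box leaves room for a radius above `1`. Capping it at `2` keeps the
  -- smallness constants independent of `U`; only order `2` enters them, while the higher orders
  -- need only be bounded.
  obtain ⟨e, he, heU⟩ :=
    (isCompact_closedBall (0 : Space du ds) 1).exists_thickening_subset_open hU hbox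
  rw [thickening_closedBall he zero_le_one] at heU
  have hball : ball (0 : Space du ds) (min (e + 1) 2) ⊆ U :=
    (ball_subset_ball (min_le_left _ _)).trans heU
  choose A₁ A₂ hd hA₁ hA₂ hA using h.differential
  obtain ⟨n, rfl⟩ := Nat.exists_eq_add_of_le' hN
  have hder : ∀ k, 2 ≤ k → k ≤ n + 2 → ∀ m, ∀ x ∈ ball (0 : Space du ds) (min (e + 1) 2),
      ‖iteratedFDeriv ℝ k (φ m) x‖ ≤ ((du + ds : ℕ) : ℝ) ^ k * δ := fun k hk hkn m x hx =>
    norm_iteratedFDeriv_le hδ fun j => h.deriv_le m k hk hkn j x (hball hx)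
  have hr : 1 < min (e + 1) 2 := lt_min (by linarith) one_lt_two
  refine ⟨min (e + 1) 2, A₁, A₂, _, hr, hA₁, hA₂, fun m x => ?_,
    isRemainder_sub (f := fun m => φ m) (n := n) (by positivity) (by linarith) (min_le_right _ _)
      (fun m => (h.contDiffOn m).mono hball) (hder 2 le_rfl (by omega))
      ⟨∑ k ∈ Finset.range (n + 3), ((du + ds : ℕ) : ℝ) ^ k * δ, fun k hk hkn m x hx =>
        (hder k hk hkn m x hx).trans ?_⟩ h.map_zero hd⟩
  · ext <;> simp
  · exact Finset.single_le_sum (f := fun k => ((du + ds : ℕ) : ℝ) ^ k * δ)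
      (fun _ _ => by positivity) (by simp; omega)

end HypFamily

/-! ### Stable and unstable graphs as sets of half-orbits in the box -/

namespace HypFamily

open Metric

variable {du ds : ℕ}

/-- The stable component runs forward under `A₂`; the unstable one is solved for as `A₁⁻¹` of its
successor minus `A₁⁻¹` of the remainder. Both remainder terms sit at the current time, hence `σ =
0`. The factors are swapped so that the contracted one comes first. -/
theorem exists_stable {N : ℕ} (hN : 1 ≤ N) {κ ε c r : ℝ} (hκ : 0 ≤ κ) (hε : 0 ≤ ε)
    (hκε : κ + ε < 1) (hc : 0 ≤ c) (hr : 1 < r)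
    {φ : ℤ → OpenPartialHomeomorph (Space du ds) (Space du ds)}
    {A₁ : ℤ → Euc du ≃L[ℝ] Euc du} {A₂ : ℤ → Euc ds ≃L[ℝ] Euc ds}
    {f : ℤ → Space du ds → Space du ds}
    (hA₁ : ∀ m, ‖((A₁ m).symm : Euc du →L[ℝ] Euc du)‖ ≤ κ)
    (hA₂ : ∀ m, ‖(A₂ m : Euc ds →L[ℝ] Euc ds)‖ ≤ κ)
    (hφ : ∀ m x, φ m x = (A₁ m x.1 + (f m x).1, A₂ m x.2 + (f m x).2))
    (hf : IsRemainder (N + 1) ε c r f) :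
    ∃ F : ℤ → Euc ds → Euc du, IsGraphFamily N F ∧
      (∀ m x, x ∈ stableGraph (F m) ↔ ∀ n, forward φ m n x ∈ unitBox du ds) ∧
      ∀ m x, (∀ n, forward φ m n x ∈ unitBox du ds) →
        Tendsto (fun n => forward φ m n x) atTop (𝓝 0) ∧ ‖x.1‖ ≤ (κ + ε) * ‖x.2‖ := by
  let S : ℤ × ℕ → Euc ds →L[ℝ] Euc ds := fun i => A₂ (i.1 + i.2)
  let Q : ℤ × ℕ → Euc du →L[ℝ] Euc du := fun i => (A₁ (i.1 + i.2)).symm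
  let T : ℤ × ℕ → Space du ds →L[ℝ] Euc ds × Euc du := fun i =>
    (ContinuousLinearMap.snd ℝ (Euc du) (Euc ds)).prod
      (-(Q i ∘L ContinuousLinearMap.fst ℝ (Euc du) (Euc ds)))
  have hT : ∀ i, ‖T i‖ ≤ 1 := fun i => (T i).opNorm_le_bound zero_le_one fun x => by
    rw [one_mul, Prod.norm_def]
    refine max_le (norm_snd_le x) ?_
    refine (norm_neg (Q i x.1)).trans_le (((Q i).le_of_opNorm_le (hA₁ _) x.1).trans ?_)
    nlinarith [norm_fst_le x, norm_nonneg x.1]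
  have hw := hf.comp hT (fun i => i.1 + i.2) (LinearIsometryEquiv.prodComm ℝ (Euc ds) (Euc du))
  obtain ⟨F, hF, hFx⟩ := exists_graphFamily hN hκ hε hκε hc hr (S := S) (Q := Q) 0
    (fun i => hA₂ _) (fun i => hA₁ _) hw.smooth hw.map_zero hw.lipschitz hw.quadratic
  have horb : ∀ m x, (∀ n, forward φ m n x ∈ unitBox du ds) →
      IsOrbit (fun n => S (m, n)) (fun n => Q (m, n)) (fun n z => T (m, n) (f (m + n) z.swap)) 0
        (fun n => (forward φ m n x).swap) := by
    intro m x hx n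
    simp only [forward, hφ, S, Q, T, add_zero]
    constructor <;> simp
  have hbd : ∀ m x, (∀ n, forward φ m n x ∈ unitBox du ds) →
      ∀ n, ‖(forward φ m n x).swap‖ ≤ 1 := fun m x hx n => by
    rw [Prod.norm_def, max_comm]; exact hx n
  have hsmall : ∀ (m : ℤ) (n : ℕ) (z : Euc ds × Euc du), ‖z‖ ≤ 1 →
      ‖T (m, n) (f (m + n) z.swap)‖ ≤ ε * ‖z‖ := by
    intro m n z hz
    have h0 : (0 : Euc ds × Euc du) ∈ ball (0 : Euc ds × Euc du) r :=
      mem_ball_self (by linarith)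
    have h := hw.lipschitz (m, n) z (by rw [mem_ball_zero_iff]; linarith) 0 h0
    rw [hw.map_zero, sub_zero, sub_zero] at h
    exact h
  refine ⟨F, hF, fun m x => ?_, fun m x hx => ⟨?_, ?_⟩⟩
  · refine (hFx m x.swap).trans ⟨?_, fun hx => ⟨_, horb m x hx, rfl, hbd m x hx⟩⟩
    rintro ⟨z, hz, hz0, hz1⟩
    have hzx : ∀ n, forward φ m n x = (z n).swap := by
      intro n
      induction n with
      | zero => rw [hz0]; rfl
      | succ n ih =>
        have h1 := (hz n).1
        have h2 := (hz n).2
        have h3 : Q (m, n) (A₁ (m + n) (z n).2) = (z n).2 := (A₁ (m + n)).symm_apply_apply _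
        rw [forward, ih, hφ]
        refine Prod.ext ?_ h1.symm
        change A₁ (m + n) (z n).2 + (f (m + n) (z n).swap).1 = (z (n + 1)).2
        change (z n).2 = Q (m, n) (z (n + 1)).2 + -(Q (m, n) (f (m + n) (z n).swap).1) at h2
        -- Undoing the backward form of the recursion: the equation is compared after applying
        -- `A₁⁻¹`.
        apply (A₁ (m + n)).symm.injective
        change Q (m, n) (A₁ (m + n) (z n).2 + (f (m + n) (z n).swap).1) = Q (m, n) (z (n + 1)).2
        rw [map_add, h3, h2]
        abel
    intro n
    rw [hzx, mem_unitBox, Prod.norm_def, max_comm]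
    exact hz1 n
  · have h := (horb m x hx).tendsto_zero hε hκε (fun n => hA₂ _) (fun n => hA₁ _) (hsmall m)
      (hbd m x hx)
    exact (continuous_swap.tendsto (0 : Euc ds × Euc du)).comp h
  · exact (horb m x hx).norm_snd_zero_le hε hκε (fun n => hA₂ _) (fun n => hA₁ _) (hsmall m)
      (hbd m x hx)

/-- The recursion expresses `x n = φ (m - (n + 1)) (x (n + 1))` through the maps themselves, so no
derivative bounds on their inverses are needed. The remainder is evaluated at the next point of the
backward orbit, hence `σ = 1`. -/
theorem exists_unstable {N : ℕ} (hN : 1 ≤ N) {κ ε c r : ℝ} (hκ : 0 ≤ κ) (hε : 0 ≤ ε)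
    (hκε : κ + ε < 1) (hc : 0 ≤ c) (hr : 1 < r)
    {φ : ℤ → OpenPartialHomeomorph (Space du ds) (Space du ds)}
    (hφs : ∀ m, unitBox du ds ⊆ (φ m).source) (hφt : ∀ m, unitBox du ds ⊆ (φ m).target)
    {A₁ : ℤ → Euc du ≃L[ℝ] Euc du} {A₂ : ℤ → Euc ds ≃L[ℝ] Euc ds}
    {f : ℤ → Space du ds → Space du ds}
    (hA₁ : ∀ m, ‖((A₁ m).symm : Euc du →L[ℝ] Euc du)‖ ≤ κ)
    (hA₂ : ∀ m, ‖(A₂ m : Euc ds →L[ℝ] Euc ds)‖ ≤ κ)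
    (hφ : ∀ m x, φ m x = (A₁ m x.1 + (f m x).1, A₂ m x.2 + (f m x).2))
    (hf : IsRemainder (N + 1) ε c r f) :
    ∃ F : ℤ → Euc du → Euc ds, IsGraphFamily N F ∧
      (∀ m x, x ∈ unstableGraph (F m) ↔ ∀ n, backward φ m n x ∈ unitBox du ds) ∧
      ∀ m x, (∀ n, backward φ m n x ∈ unitBox du ds) →
        Tendsto (fun n => backward φ m n x) atTop (𝓝 0) ∧ ‖x.2‖ ≤ (κ + ε) * ‖x.1‖ := by
  let S : ℤ × ℕ → Euc du →L[ℝ] Euc du := fun i => (A₁ (i.1 - (i.2 + 1))).symm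
  let Q : ℤ × ℕ → Euc ds →L[ℝ] Euc ds := fun i => A₂ (i.1 - (i.2 + 1))
  -- There is no `+ 1` here, unlike in `S` and `Q`: the shift `σ = 1` supplies it.
  let T : ℤ × ℕ → Space du ds →L[ℝ] Space du ds := fun i =>
    (-(((A₁ (i.1 - i.2)).symm : Euc du →L[ℝ] Euc du) ∘L
      ContinuousLinearMap.fst ℝ (Euc du) (Euc ds))).prod
      (ContinuousLinearMap.snd ℝ (Euc du) (Euc ds))
  have hT : ∀ i, ‖T i‖ ≤ 1 := fun i => (T i).opNorm_le_bound zero_le_one fun x => by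
    rw [one_mul, Prod.norm_def]
    refine max_le ?_ (norm_snd_le x)
    refine (norm_neg ((A₁ (i.1 - i.2)).symm x.1)).trans_le
      ((((A₁ (i.1 - i.2)).symm : Euc du →L[ℝ] Euc du).le_of_opNorm_le (hA₁ _) x.1).trans ?_)
    nlinarith [norm_fst_le x, norm_nonneg x.1]
  have hw := hf.comp hT (fun i => i.1 - i.2) (LinearIsometryEquiv.refl ℝ (Space du ds))
  obtain ⟨F, hF, hFx⟩ := exists_graphFamily hN hκ hε hκε hc hr (S := S) (Q := Q) 1
    (fun i => hA₁ _) (fun i => hA₂ _) hw.smooth hw.map_zero hw.lipschitz hw.quadratic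
  have horb : ∀ m x, (∀ n, backward φ m n x ∈ unitBox du ds) →
      IsOrbit (fun n => S (m, n)) (fun n => Q (m, n)) (fun n z => T (m, n) (f (m - n) z)) 1
        (fun n => backward φ m n x) := by
    intro m x hx n
    have hstep : φ (m - (n + 1)) (backward φ m (n + 1) x) = backward φ m n x :=
      (φ (m - (n + 1))).right_inv (hφt _ (hx n))
    have hs := (hφ _ _).symm.trans hstep
    have h1 := congrArg Prod.fst hs
    have h2 := congrArg Prod.snd hs
    simp only at h1 h2
    simp only [S, Q, T, ← h1, ← h2]
    constructor <;> simp
  have hsmall : ∀ m (n : ℕ) z, ‖z‖ ≤ 1 → ‖T (m, n) (f (m - n) z)‖ ≤ ε * ‖z‖ := by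
    intro m n z hz
    have h0 : (0 : Space du ds) ∈ ball (0 : Space du ds) r := mem_ball_self (by linarith)
    have h := hw.lipschitz (m, n) z (by rw [mem_ball_zero_iff]; linarith) 0 h0
    rw [hw.map_zero, sub_zero, sub_zero] at h
    exact h
  refine ⟨F, hF, fun m x => ?_, fun m x hx => ⟨?_, ?_⟩⟩
  · refine (hFx m x).trans ⟨?_, fun hx => ⟨_, horb m x hx, rfl, hx⟩⟩
    rintro ⟨z, hz, hz0, hz1⟩
    have hzx : ∀ n, backward φ m n x = z n := by
      intro n
      induction n with
      | zero => rw [hz0]; rfl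
      | succ n ih =>
        have h1 := (hz n).1
        have h2 := (hz n).2
        have hstep : φ (m - (n + 1)) (z (n + 1)) = z n := by
          rw [hφ]
          refine Prod.ext ?_ ?_
          · rw [h1]
            simp [S, T]
          · rw [h2]
            simp [Q, T]
        rw [backward, ih, ← hstep]
        exact (φ (m - (n + 1))).left_inv (hφs _ (hz1 (n + 1)))
    intro n
    rw [hzx]
    exact hz1 n
  · exact (horb m x hx).tendsto_zero hε hκε (fun n => hA₁ _) (fun n => hA₂ _) (hsmall m) hx
  · exact (horb m x hx).norm_snd_zero_le hε hκε (fun n => hA₁ _) (fun n => hA₂ _) (hsmall m) hx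

/-- Splitting off the first map instead of the last turns invariance of the graphs into a shift of
orbits. -/
theorem forward_succ' {X : Type*} [TopologicalSpace X] (φ : ℤ → OpenPartialHomeomorph X X) (m : ℤ)
    (n : ℕ) (x : X) : forward φ m (n + 1) x = forward φ (m + 1) n (φ m x) := by
  induction n with
  | zero => simp [forward]
  | succ n ih =>
    rw [forward, ih, forward]
    congr 2
    push_cast
    ring

theorem backward_succ' {X : Type*} [TopologicalSpace X] (φ : ℤ → OpenPartialHomeomorph X X)
    (m : ℤ) (n : ℕ) (x : X) :
    backward φ (m + 1) (n + 1) x = backward φ m n ((φ m).symm x) := by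
  induction n with
  | zero => simp [backward]
  | succ n ih =>
    rw [backward, ih, backward]
    congr 3
    push_cast
    ring

end HypFamily

/-! ### Assembly of the theorem -/

theorem theoremt (d N : ℕ) (hN : 1 ≤ N) (lam μ C₀ : ℝ) (hlam0 : 0 < lam) (hlam1 : lam < 1)
    (hμ : 1 < μ) (hC₀ : 0 < C₀) :
    ∃ δ : ℝ, 0 < δ ∧
      ∀ (du ds : ℕ), du + ds = d →
      ∀ (U V : Set (HypFamily.Space du ds))
        (φ : ℤ → OpenPartialHomeomorph (HypFamily.Space du ds) (HypFamily.Space du ds)),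
        HypFamily.IsHyperbolic N lam μ C₀ δ U V φ →
        ∃ (Fu : ℤ → HypFamily.Euc du → HypFamily.Euc ds)
          (Fs : ℤ → HypFamily.Euc ds → HypFamily.Euc du)
          (Wu Ws : ℤ → Set (HypFamily.Space du ds)),
          HypFamily.IsGraphFamily N Fu ∧
          HypFamily.IsGraphFamily N Fs ∧
          (∀ m, Wu m = HypFamily.unstableGraph (Fu m)) ∧
          (∀ m, Ws m = HypFamily.stableGraph (Fs m)) ∧
          ∀ m : ℤ,
            -- (1) invariance
            ((φ m).symm '' Wu (m + 1) ⊆ Wu m ∧ φ m '' Ws m ⊆ Ws (m + 1) ∧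
              φ m '' Wu m ∩ HypFamily.unitBox du ds = Wu (m + 1) ∧
              (φ m).symm '' Ws (m + 1) ∩ HypFamily.unitBox du ds = Ws m) ∧
            -- (2) intersection
            Wu m ∩ Ws m = {0} ∧
            -- (3), (4) convergence of the orbits
            (∀ x ∈ Wu m, Tendsto (fun n : ℕ => HypFamily.backward φ m n x) atTop (𝓝 0)) ∧
            (∀ x ∈ Ws m, Tendsto (fun n : ℕ => HypFamily.forward φ m n x) atTop (𝓝 0)) ∧
            -- (5), (6) characterization by orbits that stay in the unit ball
            (∀ x, (∀ n : ℕ, HypFamily.backward φ m n x ∈ HypFamily.unitBox du ds) → x ∈ Wu m) ∧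
            (∀ x, (∀ n : ℕ, HypFamily.forward φ m n x ∈ HypFamily.unitBox du ds) → x ∈ Ws m) := by
  obtain ⟨κ, hκlam, hκμ, hκ0, hκ1⟩ : ∃ κ : ℝ, lam ≤ κ ∧ μ⁻¹ ≤ κ ∧ 0 ≤ κ ∧ κ < 1 :=
    ⟨max lam μ⁻¹, le_max_left _ _, le_max_right _ _, le_max_of_le_left hlam0.le,
      max_lt hlam1 (inv_lt_one_of_one_lt₀ hμ)⟩
  -- The Lipschitz constant of the remainder is `2 * d ^ 2 * δ`, which this choice keeps below `(1 -
  -- κ) / 2`; the `+ 1` covers `d = 0`.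
  refine ⟨(1 - κ) / (4 * ((d : ℝ) ^ 2 + 1)), div_pos (by linarith) (by positivity), ?_⟩
  rintro du ds rfl U V φ h
  set δ := (1 - κ) / (4 * (((du + ds : ℕ) : ℝ) ^ 2 + 1)) with hδ
  have hδ0 : 0 ≤ δ := div_nonneg (by linarith) (by positivity)
  obtain ⟨r, A₁, A₂, f, hr, hA₁, hA₂, hφ, hf⟩ := h.exists_splitting hN hδ0
  set ε := 2 * (((du + ds : ℕ) : ℝ) ^ 2 * δ) with hε
  have hε0 : 0 ≤ ε := by positivity
  have hκε : κ + ε < 1 := by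
    have h1 : 4 * (((du + ds : ℕ) : ℝ) ^ 2 + 1) * δ = 1 - κ := by
      rw [hδ]; field_simp
    nlinarith
  have hbox : ∀ m, HypFamily.unitBox du ds ⊆ (φ m).source := fun m x hx => by
    rw [h.source_eq]; exact (h.box_subset hx).1
  have hbox' : ∀ m, HypFamily.unitBox du ds ⊆ (φ m).target := fun m x hx => by
    rw [h.target_eq]; exact (h.box_subset hx).2
  obtain ⟨Fs, hFs, hWs, hs⟩ := HypFamily.exists_stable hN hκ0 hε0 hκε (by positivity) hr
    (fun m => (hA₁ m).trans hκμ) (fun m => (hA₂ m).trans hκlam) hφ hf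
  obtain ⟨Fu, hFu, hWu, hu⟩ := HypFamily.exists_unstable hN hκ0 hε0 hκε (by positivity) hr
    hbox hbox' (fun m => (hA₁ m).trans hκμ) (fun m => (hA₂ m).trans hκlam) hφ hf
  have hsbox : ∀ m, HypFamily.stableGraph (Fs m) ⊆ HypFamily.unitBox du ds := fun m x hx =>
    (hWs m x).mp hx 0
  have hubox : ∀ m, HypFamily.unstableGraph (Fu m) ⊆ HypFamily.unitBox du ds := fun m x hx =>
    (hWu m x).mp hx 0
  have hsmap : ∀ m, ∀ x ∈ HypFamily.stableGraph (Fs m),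
      φ m x ∈ HypFamily.stableGraph (Fs (m + 1)) := by
    intro m x hx
    rw [hWs] at hx ⊢
    intro n
    rw [← HypFamily.forward_succ']
    exact hx (n + 1)
  have humap : ∀ m, ∀ x ∈ HypFamily.unstableGraph (Fu (m + 1)),
      (φ m).symm x ∈ HypFamily.unstableGraph (Fu m) := by
    intro m x hx
    rw [hWu] at hx ⊢
    intro n
    rw [← HypFamily.backward_succ']
    exact hx (n + 1)
  refine ⟨Fu, Fs, _, _, hFu, hFs, fun m => rfl, fun m => rfl, fun m =>
    ⟨⟨?_, ?_, ?_, ?_⟩, ?_, ?_, ?_, fun x hx => (hWu m x).mpr hx, fun x hx => (hWs m x).mpr hx⟩⟩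
  · rintro _ ⟨x, hx, rfl⟩
    exact humap m x hx
  · rintro _ ⟨x, hx, rfl⟩
    exact hsmap m x hx
  · refine Subset.antisymm ?_ fun x hx => ⟨⟨_, humap m x hx, (φ m).right_inv
      (hbox' m (hubox _ hx))⟩, hubox _ hx⟩
    rintro _ ⟨⟨x, hx, rfl⟩, hxb⟩
    rw [hWu]
    -- The backward orbit of `φ m x` is this point, which lies in the box by assumption, followed by
    -- the backward orbit of `x`.
    rintro (_ | n)
    · exact hxb
    · rw [HypFamily.backward_succ', (φ m).left_inv (hbox m (hubox m hx))]
      exact (hWu m x).mp hx n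
  · refine Subset.antisymm ?_ fun x hx => ⟨⟨_, hsmap m x hx, (φ m).left_inv
      (hbox m (hsbox _ hx))⟩, hsbox _ hx⟩
    rintro _ ⟨⟨x, hx, rfl⟩, hxb⟩
    rw [hWs]
    rintro (_ | n)
    · exact hxb
    · rw [HypFamily.forward_succ', (φ m).right_inv (hbox' m (hsbox _ hx))]
      exact (hWs (m + 1) x).mp hx n
  · refine Subset.antisymm ?_ ?_
    · rintro x ⟨hxu, hxs⟩
      -- The two cone bounds have slope `κ + ε < 1` and hold together only at `0`.
      have h1 := (hu m x ((hWu m x).mp hxu)).2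
      have h2 := (hs m x ((hWs m x).mp hxs)).2
      have h3 : ‖x.1‖ ≤ 0 := by
        nlinarith [norm_nonneg x.1, norm_nonneg x.2, add_nonneg hκ0 hε0]
      have h4 : ‖x.2‖ ≤ 0 := h1.trans (mul_nonpos_of_nonneg_of_nonpos (by positivity) h3)
      exact Prod.ext (norm_le_zero_iff.mp h3) (norm_le_zero_iff.mp h4)
    · rintro _ rfl
      exact ⟨⟨by simp, (hFu.map_zero m).symm⟩, ⟨by simp, (hFs.map_zero m).symm⟩⟩
  · exact fun x hx => (hu m x ((hWu m x).mp hx)).1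
  · exact fun x hx => (hs m x ((hWs m x).mp hx)).1
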